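/- Let $m$ be the Lebesgue measure on the unit circle $\mathbb T$, normalized by $m(\mathbb T)=1$. For a finite positive Borel measure $\rho$ on $\mathbb T$ and $n\ge 1$ put $$e_n(\rho)=\min_{q_0,\dots,q_{n-1}\in\mathbb C}\Bigl(\int_{\mathbb T}\bigl|q_0+q_1t+\dots+q_{n-1}t^{n-1}+t^n\bigr|^2\,d\rho(t)\Bigr)^{1/2}.$$ For a measurable function $H\colon\mathbb T\to[0,+\infty]$ let $\lambda_H(a)=m\{t\in\mathbb T: H(t)>a\}$. For every $C>0$ there is $K>0$, depending only on $C$, such that the following holds. Let $H\colon\mathbb T\to[0,+\infty]$ be measurable and belong to the weak $L^1(m)$-space with constant $C$, that is, $\lambda_H(a)\le C/a$ for all $a\ge 1$. Let $\rho$ be a finite positive Borel measure on $\mathbb T$ with $d\rho\ge e^{-H}\,dm$ (where $e^{-\infty}=0$). Then $e_n(\rho)$ decays to zero no faster than the power $n^{-K}$: there is $c>0$ (which may depend on $H$ and $\rho$) such that $$e_n(\rho)\ge c\,n^{-K}\qquad\text{for all } n\ge 1.$$ -/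

import Mathlib

open MeasureTheory
open scoped ENNReal

/-- The unit circle carries its Borel σ-algebra. -/
noncomputable instance circleMeasurableSpace : MeasurableSpace Circle := borel Circle

instance circleBorelSpace : BorelSpace Circle := ⟨rfl⟩

/-- Lebesgue (arc length) measure `m` on the unit circle, normalized by `m(𝕋) = 1`: the image of
`dθ / 2π` on `(0, 2π]` under `θ ↦ exp (iθ)`. -/
noncomputable def circleLebesgue : Measure Circle :=
  Measure.map Circle.exp
    (ENNReal.ofReal (2 * Real.pi)⁻¹ • volume.restrict (Set.Ioc (0 : ℝ) (2 * Real.pi)))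

/-- The distribution function `λ_H(a) = m {H > a}` of `H : 𝕋 → [0, ∞]`, for `a ≥ 0`. -/
noncomputable def distribFun (H : Circle → ℝ≥0∞) (a : ℝ) : ℝ :=
  circleLebesgue.real {t | ENNReal.ofReal a < H t}

/-- The measure `e^{-H} dm`, where `e^{-∞} = 0`. -/
noncomputable def expNegMeasure (H : Circle → ℝ≥0∞) : Measure Circle :=
  circleLebesgue.withDensity fun t => EReal.exp (-(H t : EReal))

/-- `e_n(ρ)`: the minimum over `q_0, …, q_{n-1} ∈ ℂ` of
`(∫ |q_0 + q_1 t + ⋯ + q_{n-1} t^{n-1} + t^n|² dρ(t))^{1/2}`, that is, the distance in `L²(ρ)`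
from `t^n` to the polynomials of degree at most `n - 1`. -/
noncomputable def predError (ρ : Measure Circle) (n : ℕ) : ℝ :=
  ⨅ q : Fin n → ℂ,
    √(∫ t : Circle, ‖(∑ k : Fin n, q k * (t : ℂ) ^ (k : ℕ)) + (t : ℂ) ^ n‖ ^ 2 ∂ρ)

/-! Let `P` be monic of degree `n`, `N = n + 1` and `u = log |P|²`. The Mahler measure of `P` is at
least `1`, so `∫ u dm ≥ 0`; as `P` has at most `N` coefficients, `|P|² ≤ N ∫ |P|² dm` pointwise.
Let `E = {H ≤ a}` with `a` a large constant times `N`, so that the exceptional set `{H > a}` has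
measure at most `1 / (2N)`; then it carries at most half of the mass of `|P|²`. If
`∫_E |P|² e^{-H} dm ≥ 1` there is nothing to prove. Otherwise `∫ |P|² dm ≤ 2 e^a`, hence
`u ≤ log (2N) + a = O(N)`, and the exceptional set contributes at most `O(1)` to `∫ u dm`: thus
`∫_E u dm` is bounded below independently of `n`. The weak-type bound gives
`∫_E H dm ≤ 1 + C log a`, and Jensen's inequality for `exp (u - H)` on `E` turns the two bounds into
a power of `n`. -/

open Polynomial Real

section WeakL1

variable {α : Type*} {mα : MeasurableSpace α} {μ : Measure α}

/-- `H : α → [0, ∞]` belongs to the weak `L¹(μ)`-space with constant `D`. Only the tail `a ≥ 1` of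
the distribution function is constrained; on a probability space the bound on `0 < a < 1` is
automatic when `D ≥ 1`. -/
def MemWeakL1With (D : ℝ) (H : α → ℝ≥0∞) (μ : Measure α) : Prop :=
  ∀ a : ℝ, 1 ≤ a → μ.real {t | ENNReal.ofReal a < H t} ≤ D / a

theorem MemWeakL1With.mono {C D : ℝ} {H : α → ℝ≥0∞} (hH : MemWeakL1With C H μ) (hCD : C ≤ D) :
    MemWeakL1With D H μ :=
  fun a ha => (hH a ha).trans (by gcongr)

theorem intervalIntegrable_measureReal_lt [IsFiniteMeasure μ] (f : α → ℝ) (a b : ℝ) :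
    IntervalIntegrable (fun s => μ.real {t | s < f t}) volume a b :=
  Antitone.intervalIntegrable fun _ _ hrs => measureReal_mono fun _ ht => hrs.trans_lt ht

theorem integral_eq_intervalIntegral_measureReal_lt {f : α → ℝ} (hf : Integrable f μ)
    (hf0 : 0 ≤ᵐ[μ] f) {a : ℝ} (ha : 0 ≤ a) (hfa : ∀ᵐ t ∂μ, f t ≤ a) :
    ∫ t, f t ∂μ = ∫ s in 0..a, μ.real {t | s < f t} := by
  rw [hf.integral_eq_integral_meas_lt hf0, intervalIntegral.integral_of_le ha]
  refine setIntegral_eq_of_subset_of_forall_sdiff_eq_zero measurableSet_Ioi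
    (fun s hs => hs.1) fun s hs => ?_
  have has : a < s := lt_of_not_ge fun hsa => hs.2 ⟨hs.1, hsa⟩
  have hnull : μ {t | s < f t} = 0 :=
    measure_mono_null (fun t ht => not_le.2 (has.trans ht)) hfa
  rw [measureReal_def, hnull, ENNReal.toReal_zero]

theorem integral_le_measureReal_univ_add_mul_log [IsFiniteMeasure μ] {f : α → ℝ}
    (hf : Integrable f μ) (hf0 : 0 ≤ᵐ[μ] f) {a D : ℝ} (ha : 1 ≤ a) (hfa : ∀ᵐ t ∂μ, f t ≤ a)
    (hD : ∀ s ∈ Set.Icc 1 a, μ.real {t | s < f t} ≤ D / s) :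
    ∫ t, f t ∂μ ≤ μ.real Set.univ + D * log a := by
  have hint := intervalIntegrable_measureReal_lt (μ := μ) f
  have hinv : IntervalIntegrable (fun s : ℝ => D / s) volume 1 a := by
    simp only [div_eq_mul_inv]
    refine (intervalIntegral.intervalIntegrable_inv (fun s hs => ?_) continuousOn_id).const_mul D
    rw [Set.uIcc_of_le ha] at hs
    exact (zero_lt_one.trans_le hs.1).ne'
  calc ∫ t, f t ∂μ
      = (∫ s in 0..1, μ.real {t | s < f t}) + ∫ s in 1..a, μ.real {t | s < f t} := by
        rw [integral_eq_intervalIntegral_measureReal_lt hf hf0 (zero_le_one.trans ha) hfa,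
          intervalIntegral.integral_add_adjacent_intervals (hint 0 1) (hint 1 a)]
    _ ≤ (∫ _ in (0 : ℝ)..1, μ.real Set.univ) + ∫ s in 1..a, D / s := by
        gcongr
        · exact intervalIntegral.integral_mono_on zero_le_one (hint 0 1)
            intervalIntegrable_const fun _ _ => measureReal_mono (Set.subset_univ _)
        · exact intervalIntegral.integral_mono_on ha (hint 1 a) hinv hD
    _ = μ.real Set.univ + D * log a := by
        simp only [intervalIntegral.integral_const, sub_zero, one_smul, div_eq_mul_inv,
          intervalIntegral.integral_const_mul]
        rw [integral_inv_of_pos one_pos (by linarith), div_one]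

theorem toReal_mem_Icc_of_le_ofReal {x : ℝ≥0∞} {a : ℝ} (ha : 0 ≤ a) (hx : x ≤ ENNReal.ofReal a) :
    x.toReal ∈ Set.Icc 0 a :=
  ⟨ENNReal.toReal_nonneg, ENNReal.toReal_le_of_le_ofReal ha hx⟩

theorem MemWeakL1With.setIntegral_toReal_le [IsFiniteMeasure μ] {D : ℝ} {H : α → ℝ≥0∞}
    (hweak : MemWeakL1With D H μ) (hH : Measurable H) {a : ℝ} (ha : 1 ≤ a) :
    ∫ t in {t | H t ≤ ENNReal.ofReal a}, (H t).toReal ∂μ ≤ μ.real Set.univ + D * log a := by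
  set E := {t | H t ≤ ENNReal.ofReal a}
  have hHE : ∀ᵐ t ∂μ.restrict E, (H t).toReal ∈ Set.Icc 0 a :=
    ae_restrict_of_forall_mem (measurableSet_le hH measurable_const) fun _ ht =>
      toReal_mem_Icc_of_le_ofReal (zero_le_one.trans ha) ht
  have htail : ∀ s ∈ Set.Icc 1 a, (μ.restrict E).real {t | s < (H t).toReal} ≤ D / s :=
    fun s hs => by
      refine le_trans ?_ (hweak s hs.1)
      calc (μ.restrict E).real {t | s < (H t).toReal}
          ≤ (μ.restrict E).real {t | ENNReal.ofReal s < H t} :=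
            measureReal_mono fun t ht => lt_of_not_ge fun hle =>
              not_le.2 ht (ENNReal.toReal_le_of_le_ofReal (by linarith [hs.1]) hle)
        _ ≤ μ.real {t | ENNReal.ofReal s < H t} :=
            ENNReal.toReal_mono (measure_ne_top _ _) (Measure.restrict_apply_le _ _)
  refine (integral_le_measureReal_univ_add_mul_log
    (.of_mem_Icc 0 a hH.ennreal_toReal.aemeasurable hHE) (hHE.mono fun _ ht => ht.1) ha
    (hHE.mono fun _ ht => ht.2) htail).trans ?_
  gcongr
  rw [measureReal_restrict_apply_univ]
  exact measureReal_mono (Set.subset_univ E)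

end WeakL1

section Jensen

variable {α : Type*} {mα : MeasurableSpace α} {μ : Measure α}

theorem mul_exp_neg_div_le_integral_exp [IsFiniteMeasure μ] {g : α → ℝ} (hg : Integrable g μ)
    (hexp : Integrable (fun t => rexp (g t)) μ) {θ B : ℝ} (hθ : 0 < θ) (hθμ : θ ≤ μ.real Set.univ)
    (hB : 0 ≤ B) (hgB : -B ≤ ∫ t, g t ∂μ) :
    θ * rexp (-(B / θ)) ≤ ∫ t, rexp (g t) ∂μ := by
  have hμ : 0 < μ.real Set.univ := hθ.trans_le hθμ
  have : NeZero μ := ⟨fun h => by simp [h] at hμ⟩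
  have hjensen : rexp (⨍ t, g t ∂μ) ≤ ⨍ t, rexp (g t) ∂μ :=
    convexOn_exp.map_average_le continuousOn_exp isClosed_univ (by simp) hg hexp
  have haverage : -(B / θ) ≤ ⨍ t, g t ∂μ := by
    rw [average_eq, smul_eq_mul, inv_mul_eq_div]
    calc -(B / θ) ≤ -B / μ.real Set.univ := by rw [neg_div]; gcongr
      _ ≤ _ := by gcongr
  calc θ * rexp (-(B / θ)) ≤ μ.real Set.univ * rexp (⨍ t, g t ∂μ) := by gcongr
    _ ≤ μ.real Set.univ * ⨍ t, rexp (g t) ∂μ := by gcongr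
    _ = ∫ t, rexp (g t) ∂μ := by rw [← smul_eq_mul, measure_smul_average]

theorem integral_sub_measureReal_compl_mul_le_setIntegral [IsFiniteMeasure μ] {f : α → ℝ} {M : ℝ}
    {E : Set α} (hf : Integrable f μ) (hfM : ∀ᵐ t ∂μ, f t ≤ M) (hE : MeasurableSet E) :
    ∫ t, f t ∂μ - μ.real Eᶜ * M ≤ ∫ t in E, f t ∂μ := by
  have hcompl : ∫ t in Eᶜ, f t ∂μ ≤ μ.real Eᶜ * M := by
    calc ∫ t in Eᶜ, f t ∂μ ≤ ∫ _ in Eᶜ, M ∂μ :=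
          setIntegral_mono_ae hf.integrableOn integrableOn_const hfM
      _ = μ.real Eᶜ * M := by rw [setIntegral_const, smul_eq_mul]
  linarith [integral_add_compl hE hf]

theorem integrableOn_exp_sub {u h : α → ℝ} {E : Set α}
    (hexp : Integrable (fun t => rexp (u t)) μ) (hE : MeasurableSet E)
    (hh : AEStronglyMeasurable h (μ.restrict E)) (hh0 : ∀ t ∈ E, 0 ≤ h t) :
    IntegrableOn (fun t => rexp (u t - h t)) E μ := by
  simp only [sub_eq_add_neg, exp_add]
  refine hexp.integrableOn.mul_bdd (c := 1)
    (continuous_exp.comp_aestronglyMeasurable hh.neg) ?_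
  refine ae_restrict_of_forall_mem hE fun t ht => ?_
  rw [norm_of_nonneg (exp_pos _).le]
  exact exp_le_one_iff.2 (neg_nonpos.2 (hh0 t ht))

variable {u h : α → ℝ} {E : Set α} {N a : ℝ}

theorem setIntegral_exp_le_exp_mul_setIntegral_exp_sub
    (hexp : Integrable (fun t => rexp (u t)) μ) (hE : MeasurableSet E)
    (hh : AEStronglyMeasurable h (μ.restrict E)) (hhE : ∀ t ∈ E, h t ∈ Set.Icc 0 a) :
    ∫ t in E, rexp (u t) ∂μ ≤ rexp a * ∫ t in E, rexp (u t - h t) ∂μ := by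
  rw [← integral_const_mul]
  refine setIntegral_mono_on hexp.integrableOn
    ((integrableOn_exp_sub hexp hE hh fun t ht => (hhE t ht).1).const_mul _) hE fun t ht => ?_
  rw [← exp_add, exp_le_exp]
  linarith [(hhE t ht).2]

theorem ae_le_log_add_of_setIntegral_exp_sub_le_one [IsFiniteMeasure μ] (hN : 0 < N)
    (hexp : Integrable (fun t => rexp (u t)) μ)
    (hsup : ∀ᵐ t ∂μ, rexp (u t) ≤ N * ∫ s, rexp (u s) ∂μ) (hE : MeasurableSet E)
    (hEN : N * μ.real Eᶜ ≤ 1 / 2) (hh : AEStronglyMeasurable h (μ.restrict E))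
    (hhE : ∀ t ∈ E, h t ∈ Set.Icc 0 a) (hle : ∫ t in E, rexp (u t - h t) ∂μ ≤ 1) :
    ∀ᵐ t ∂μ, u t ≤ log (2 * N) + a := by
  set S := ∫ t, rexp (u t) ∂μ
  have hS0 : 0 ≤ S := integral_nonneg fun _ => (exp_pos _).le
  have hmass : S / 2 ≤ ∫ t in E, rexp (u t) ∂μ := by
    have := integral_sub_measureReal_compl_mul_le_setIntegral hexp hsup hE
    nlinarith
  have hS : S ≤ 2 * rexp a := by
    have := setIntegral_exp_le_exp_mul_setIntegral_exp_sub hexp hE hh hhE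
    nlinarith [exp_pos a]
  filter_upwards [hsup] with t ht
  rw [← exp_le_exp, exp_add, exp_log (by positivity)]
  calc rexp (u t) ≤ N * S := ht
    _ ≤ N * (2 * rexp a) := by gcongr
    _ = 2 * N * rexp a := by ring

theorem exp_div_two_le_setIntegral_exp_sub [IsProbabilityMeasure μ] (hN : 1 ≤ N) (ha : 0 ≤ a)
    (hu : Integrable u μ) (hu0 : 0 ≤ ∫ t, u t ∂μ) (hexp : Integrable (fun t => rexp (u t)) μ)
    (hsup : ∀ᵐ t ∂μ, rexp (u t) ≤ N * ∫ s, rexp (u s) ∂μ) (hE : MeasurableSet E)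
    (hEN : N * μ.real Eᶜ ≤ 1 / 2) (hh : AEStronglyMeasurable h (μ.restrict E))
    (hhE : ∀ t ∈ E, h t ∈ Set.Icc 0 a) :
    rexp (-2 * ((log (2 * N) + a) / (2 * N) + ∫ t in E, h t ∂μ)) / 2 ≤
      ∫ t in E, rexp (u t - h t) ∂μ := by
  set B := (log (2 * N) + a) / (2 * N) + ∫ t in E, h t ∂μ
  have hM0 : 0 ≤ log (2 * N) + a := add_nonneg (log_nonneg (by linarith)) ha
  have hB0 : 0 ≤ B :=
    add_nonneg (by positivity) (setIntegral_nonneg hE fun t ht => (hhE t ht).1)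
  have hcompl : μ.real Eᶜ ≤ 1 / (2 * N) := by
    rw [le_div_iff₀ (by positivity)]
    linarith
  rcases le_total 1 (∫ t in E, rexp (u t - h t) ∂μ) with hlarge | hsmall
  · have : rexp (-2 * B) ≤ 1 := exp_le_one_iff.2 (by linarith)
    linarith
  · have hh_int : IntegrableOn h E μ :=
      .of_mem_Icc 0 a hh.aemeasurable (ae_restrict_of_forall_mem hE hhE)
    have hmeasure : 1 / 2 ≤ (μ.restrict E).real Set.univ := by
      rw [measureReal_restrict_apply_univ]
      have := probReal_add_probReal_compl (μ := μ) hE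
      nlinarith [measureReal_nonneg (μ := μ) (s := Eᶜ)]
    have hu_le := ae_le_log_add_of_setIntegral_exp_sub_le_one (zero_lt_one.trans_le hN)
      hexp hsup hE hEN hh hhE hsmall
    have huE : -((log (2 * N) + a) / (2 * N)) ≤ ∫ t in E, u t ∂μ := by
      have h_loss : μ.real Eᶜ * (log (2 * N) + a) ≤ (log (2 * N) + a) / (2 * N) := by
        rw [div_eq_inv_mul, ← one_div]
        gcongr
      linarith [integral_sub_measureReal_compl_mul_le_setIntegral hu hu_le hE]
    have hB : -B ≤ ∫ t in E, (u t - h t) ∂μ := by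
      rw [integral_sub hu.integrableOn hh_int]
      simp only [B]
      linarith
    calc rexp (-2 * B) / 2 = 1 / 2 * rexp (-(B / (1 / 2))) := by ring_nf
      _ ≤ ∫ t in E, rexp (u t - h t) ∂μ :=
          mul_exp_neg_div_le_integral_exp (hu.integrableOn.sub hh_int)
            (integrableOn_exp_sub hexp hE hh fun t ht => (hhE t ht).1) one_half_pos hmeasure hB0 hB

theorem MemWeakL1With.exp_div_two_le_setIntegral_sublevel [IsProbabilityMeasure μ]
    {H : α → ℝ≥0∞} {D : ℝ} (hweak : MemWeakL1With D H μ) (hH : Measurable H) (hD : 1 ≤ D)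
    (hN : 1 ≤ N) (hu : Integrable u μ) (hu0 : 0 ≤ ∫ t, u t ∂μ)
    (hexp : Integrable (fun t => rexp (u t)) μ)
    (hsup : ∀ᵐ t ∂μ, rexp (u t) ≤ N * ∫ s, rexp (u s) ∂μ) :
    rexp (-2 * (2 + D + D * log (2 * D * N))) / 2 ≤
      ∫ t in {t | H t ≤ ENNReal.ofReal (2 * D * N)}, rexp (u t - (H t).toReal) ∂μ := by
  set a := 2 * D * N with ha_def
  set E := {t | H t ≤ ENNReal.ofReal a}
  have ha : 1 ≤ a := by nlinarith
  have ha0 : 0 ≤ a := zero_le_one.trans ha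
  have hcompl : N * μ.real Eᶜ ≤ 1 / 2 := by
    calc N * μ.real Eᶜ = N * μ.real {t | ENNReal.ofReal a < H t} := by
          simp only [E, Set.compl_ofPred, not_le]
      _ ≤ N * (D / a) := by gcongr; exact hweak a ha
      _ = 1 / 2 := by rw [ha_def]; field_simp
  have hlog : (log (2 * N) + a) / (2 * N) ≤ 1 + D := by
    rw [div_le_iff₀ (by positivity)]
    have := log_le_self (x := 2 * N) (by positivity)
    linarith
  have hHE : ∫ t in E, (H t).toReal ∂μ ≤ 1 + D * log a := by
    simpa only [probReal_univ] using hweak.setIntegral_toReal_le hH ha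
  refine le_trans ?_ (exp_div_two_le_setIntegral_exp_sub hN ha0 hu hu0 hexp hsup
    (measurableSet_le hH measurable_const) hcompl hH.ennreal_toReal.aestronglyMeasurable
    fun t ht => toReal_mem_Icc_of_le_ofReal ha0 ht)
  gcongr rexp ?_ / 2
  linarith

end Jensen

section Circle

variable {V : Type*} [NormedAddCommGroup V]

instance isProbabilityMeasure_circleLebesgue : IsProbabilityMeasure circleLebesgue where
  measure_univ := by
    rw [circleLebesgue, Measure.map_apply Circle.exp.continuous.measurable .univ,
      Set.preimage_univ, Measure.smul_apply, Measure.restrict_apply_univ, Real.volume_Ioc,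
      sub_zero, smul_eq_mul, ← ENNReal.ofReal_mul (by positivity),
      inv_mul_cancel₀ (by positivity), ENNReal.ofReal_one]

theorem circleMap_zero_one_eq_coe_circleExp (θ : ℝ) :
    circleMap 0 1 θ = (Circle.exp θ : ℂ) := by
  simp [circleMap]

instance nullSingletonClass_circleLebesgue : NullSingletonClass circleLebesgue where
  measure_singleton z := by
    have hcountable : (Circle.exp ⁻¹' {z}).Countable := by
      convert (Set.countable_singleton (z : ℂ)).preimage_circleMap 0 one_ne_zero using 1
      ext θ
      simp only [Set.mem_preimage, Set.mem_singleton_iff, circleMap_zero_one_eq_coe_circleExp,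
        Circle.coe_inj]
    rw [circleLebesgue, Measure.map_apply Circle.exp.continuous.measurable
      (measurableSet_singleton z), Measure.smul_apply, hcountable.measure_zero, smul_zero]

theorem integral_circleLebesgue_eq_circleAverage [NormedSpace ℝ V] {f : ℂ → V}
    (hf : AEStronglyMeasurable (fun t : Circle => f t) circleLebesgue) :
    ∫ t : Circle, f t ∂circleLebesgue = circleAverage f 0 1 := by
  rw [circleLebesgue, integral_map Circle.exp.continuous.measurable.aemeasurable hf,
    integral_smul_measure, ENNReal.toReal_ofReal (by positivity), circleAverage_def,
    intervalIntegral.integral_of_le (by positivity)]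
  simp only [circleMap_zero_one_eq_coe_circleExp]

theorem integrable_circleLebesgue_of_circleIntegrable {f : ℂ → V}
    (hf : AEStronglyMeasurable (fun t : Circle => f t) circleLebesgue)
    (hint : CircleIntegrable f 0 1) :
    Integrable (fun t : Circle => f t) circleLebesgue := by
  rw [circleLebesgue, integrable_map_measure hf Circle.exp.continuous.measurable.aemeasurable]
  rw [circleIntegrable_def, intervalIntegrable_iff_integrableOn_Ioc_of_le (by positivity)] at hint
  simp only [circleMap_zero_one_eq_coe_circleExp] at hint
  exact hint.integrable.smul_measure ENNReal.ofReal_ne_top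

end Circle

section Polynomial

variable {P : ℂ[X]}

theorem continuous_eval_circle (P : ℂ[X]) : Continuous fun t : Circle => P.eval (t : ℂ) :=
  P.continuous.comp continuous_subtype_val

theorem ae_eval_circle_ne_zero (hP : P ≠ 0) :
    ∀ᵐ t : Circle ∂circleLebesgue, P.eval (t : ℂ) ≠ 0 := by
  have hfinite : {t : Circle | P.eval (t : ℂ) = 0}.Finite :=
    (finite_setOfPred_isRoot hP).preimage Circle.coe_injective.injOn
  simpa only [ae_iff, not_not] using hfinite.measure_zero circleLebesgue

theorem integrable_norm_sq_eval_circle (P : ℂ[X]) (μ : Measure Circle) [IsFiniteMeasure μ] :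
    Integrable (fun t : Circle => ‖P.eval (t : ℂ)‖ ^ 2) μ :=
  ((continuous_eval_circle P).norm.pow 2).integrable_of_hasCompactSupport
    (HasCompactSupport.of_compactSpace _)

theorem integral_norm_sq_eval_circle (P : ℂ[X]) :
    ∫ t : Circle, ‖P.eval (t : ℂ)‖ ^ 2 ∂circleLebesgue = ∑ i ∈ P.support, ‖P.coeff i‖ ^ 2 := by
  rw [P.sum_sq_norm_coeff_eq_circleAverage]
  exact integral_circleLebesgue_eq_circleAverage (f := fun z => ‖P.eval z‖ ^ 2)
    (integrable_norm_sq_eval_circle P circleLebesgue).aestronglyMeasurable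

theorem norm_sq_eval_circle_le (P : ℂ[X]) (t : Circle) :
    ‖P.eval (t : ℂ)‖ ^ 2 ≤
      (P.natDegree + 1) * ∫ s : Circle, ‖P.eval (s : ℂ)‖ ^ 2 ∂circleLebesgue := by
  rw [integral_norm_sq_eval_circle, eval_eq_sum, P.sum_def]
  calc ‖∑ i ∈ P.support, P.coeff i * (t : ℂ) ^ i‖ ^ 2
      ≤ (∑ i ∈ P.support, ‖P.coeff i‖) ^ 2 := by
        gcongr
        refine (norm_sum_le _ _).trans_eq ?_
        simp only [norm_mul, norm_pow, Circle.norm_coe, one_pow, mul_one]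
    _ ≤ P.support.card * ∑ i ∈ P.support, ‖P.coeff i‖ ^ 2 := sq_sum_le_card_mul_sum_sq
    _ ≤ (P.natDegree + 1) * ∑ i ∈ P.support, ‖P.coeff i‖ ^ 2 := by
        gcongr
        exact_mod_cast P.card_supp_le_succ_natDegree

theorem aestronglyMeasurable_log_norm_eval_circle (P : ℂ[X]) :
    AEStronglyMeasurable (fun t : Circle => log ‖P.eval (t : ℂ)‖) circleLebesgue :=
  (continuous_eval_circle P).norm.measurable.log.aestronglyMeasurable

theorem integrable_log_norm_eval_circle (P : ℂ[X]) :
    Integrable (fun t : Circle => log ‖P.eval (t : ℂ)‖) circleLebesgue :=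
  integrable_circleLebesgue_of_circleIntegrable (f := fun z => log ‖P.eval z‖)
    (aestronglyMeasurable_log_norm_eval_circle P) P.intervalIntegrable_mahlerMeasure

theorem integral_log_norm_eval_circle_nonneg (hP : 1 ≤ ‖P.leadingCoeff‖) :
    0 ≤ ∫ t : Circle, log ‖P.eval (t : ℂ)‖ ∂circleLebesgue := by
  calc 0 ≤ log P.mahlerMeasure := log_nonneg (one_le_mahlerMeasure_of_one_le_norm_leadingCoeff hP)
    _ = P.logMahlerMeasure := logMahlerMeasure_eq_log_MahlerMeasure.symm
    _ = ∫ t : Circle, log ‖P.eval (t : ℂ)‖ ∂circleLebesgue :=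
        (integral_circleLebesgue_eq_circleAverage (f := fun z => log ‖P.eval z‖)
          (aestronglyMeasurable_log_norm_eval_circle P)).symm

theorem ae_exp_two_mul_log_norm_eval_circle (hP : P ≠ 0) :
    ∀ᵐ t : Circle ∂circleLebesgue,
      rexp (2 * log ‖P.eval (t : ℂ)‖) = ‖P.eval (t : ℂ)‖ ^ 2 := by
  filter_upwards [ae_eval_circle_ne_zero hP] with t ht
  rw [mul_comm, exp_mul, exp_log (norm_pos_iff.2 ht), rpow_two]

end Polynomial

section PredictionError

variable {H : Circle → ℝ≥0∞} {ρ : Measure Circle}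

theorem toReal_ereal_exp_neg_coe {x : ℝ≥0∞} (hx : x ≠ ∞) :
    (EReal.exp (-(x : EReal))).toReal = rexp (-x.toReal) := by
  rw [← EReal.coe_ennreal_toReal hx, ← EReal.coe_neg, EReal.exp_coe,
    ENNReal.toReal_ofReal (exp_pos _).le]

theorem setIntegral_mul_exp_neg_le_integral (hH : Measurable H) (hρ : expNegMeasure H ≤ ρ)
    {f : Circle → ℝ} (hf : Integrable f ρ) (hf0 : 0 ≤ f) {E : Set Circle} (hE : MeasurableSet E)
    (hHE : ∀ t ∈ E, H t ≠ ∞) :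
    ∫ t in E, f t * rexp (-(H t).toReal) ∂circleLebesgue ≤ ∫ t, f t ∂ρ := by
  have hdensity : Measurable fun t => EReal.exp (-(H t : EReal)) :=
    (measurable_coe_ennreal_ereal.comp hH).neg.ereal_exp
  have hdensity_lt_top : ∀ t, EReal.exp (-(H t : EReal)) < ∞ := fun t =>
    lt_of_le_of_lt (EReal.exp_le_one_iff.2 (EReal.neg_le_zero.2 (EReal.coe_ennreal_nonneg _)))
      ENNReal.one_lt_top
  calc ∫ t in E, f t * rexp (-(H t).toReal) ∂circleLebesgue
      = ∫ t in E, (EReal.exp (-(H t : EReal))).toReal • f t ∂circleLebesgue :=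
        setIntegral_congr_fun hE fun t ht => by
          simp only [toReal_ereal_exp_neg_coe (hHE t ht), smul_eq_mul, mul_comm]
    _ = ∫ t in E, f t ∂expNegMeasure H :=
        (setIntegral_withDensity_eq_setIntegral_toReal_smul hdensity
          (.of_forall hdensity_lt_top) f hE).symm
    _ ≤ ∫ t in E, f t ∂ρ :=
        integral_mono_measure (Measure.restrict_mono_measure hρ E) (.of_forall hf0) hf.integrableOn
    _ ≤ ∫ t, f t ∂ρ := setIntegral_le_integral hf (.of_forall hf0)

theorem exp_div_two_le_integral_norm_sq_eval [IsFiniteMeasure ρ] {D : ℝ}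
    (hweak : MemWeakL1With D H circleLebesgue) (hH : Measurable H) (hD : 1 ≤ D)
    (hρ : expNegMeasure H ≤ ρ) {P : ℂ[X]} (hP : 1 ≤ ‖P.leadingCoeff‖) :
    rexp (-2 * (2 + D + D * log (2 * D * (P.natDegree + 1)))) / 2 ≤
      ∫ t, ‖P.eval (t : ℂ)‖ ^ 2 ∂ρ := by
  have hP0 : P ≠ 0 := by rintro rfl; norm_num at hP
  have hexp := ae_exp_two_mul_log_norm_eval_circle hP0
  have hint := integrable_norm_sq_eval_circle P circleLebesgue
  have hlog_nonneg : 0 ≤ ∫ t : Circle, 2 * log ‖P.eval (t : ℂ)‖ ∂circleLebesgue := by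
    rw [integral_const_mul]
    exact mul_nonneg zero_le_two (integral_log_norm_eval_circle_nonneg hP)
  have hsup : ∀ᵐ t : Circle ∂circleLebesgue, rexp (2 * log ‖P.eval (t : ℂ)‖) ≤
      (P.natDegree + 1) * ∫ s : Circle, rexp (2 * log ‖P.eval (s : ℂ)‖) ∂circleLebesgue := by
    filter_upwards [hexp] with t ht
    rw [ht, integral_congr_ae hexp]
    exact norm_sq_eval_circle_le P t
  set a : ℝ := 2 * D * (P.natDegree + 1)
  calc rexp (-2 * (2 + D + D * log a)) / 2
      ≤ ∫ t : Circle in {t | H t ≤ ENNReal.ofReal a},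
          rexp (2 * log ‖P.eval (t : ℂ)‖ - (H t).toReal) ∂circleLebesgue :=
        hweak.exp_div_two_le_setIntegral_sublevel hH hD (by simp)
          ((integrable_log_norm_eval_circle P).const_mul 2) hlog_nonneg
          (hint.congr (Filter.EventuallyEq.symm hexp)) hsup
    _ = ∫ t : Circle in {t | H t ≤ ENNReal.ofReal a},
          ‖P.eval (t : ℂ)‖ ^ 2 * rexp (-(H t).toReal) ∂circleLebesgue := by
        refine integral_congr_ae (ae_restrict_of_ae ?_)
        filter_upwards [hexp] with t ht
        rw [sub_eq_add_neg, exp_add, ht]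
    _ ≤ ∫ t, ‖P.eval (t : ℂ)‖ ^ 2 ∂ρ :=
        setIntegral_mul_exp_neg_le_integral hH hρ (integrable_norm_sq_eval_circle P ρ)
          (fun _ => by positivity) (measurableSet_le hH measurable_const)
          fun _ ht => ne_top_of_le_ne_top ENNReal.ofReal_ne_top ht

theorem le_predError_of_forall_monic {n : ℕ} {b : ℝ}
    (hb : ∀ P : ℂ[X], P.Monic → P.natDegree = n → b ≤ √(∫ t, ‖P.eval (t : ℂ)‖ ^ 2 ∂ρ)) :
    b ≤ predError ρ n := by
  refine le_ciInf fun q => ?_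
  have hdegree := degree_sum_fin_lt q
  have hnatDegree : (X ^ n + ∑ k : Fin n, C (q k) * X ^ (k : ℕ)).natDegree = n := by
    refine natDegree_eq_of_degree_eq_some ?_
    rw [degree_add_eq_left_of_degree_lt (by simpa using hdegree), degree_X_pow]
  simpa [eval_finsetSum, add_comm] using hb _ (monic_X_pow_add hdegree) hnatDegree

theorem exp_mul_rpow_div_sqrt_two_le_predError [IsFiniteMeasure ρ] {D : ℝ}
    (hweak : MemWeakL1With D H circleLebesgue) (hH : Measurable H) (hD : 1 ≤ D)
    (hρ : expNegMeasure H ≤ ρ) (n : ℕ) :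
    rexp (-(2 + D)) * (2 * D * (n + 1)) ^ (-D) / √2 ≤ predError ρ n := by
  refine le_predError_of_forall_monic fun P hP hPn => le_sqrt_of_sq_le ?_
  convert exp_div_two_le_integral_norm_sq_eval hweak hH hD hρ (P := P) (by simp [hP]) using 1
  rw [hPn, div_pow, sq_sqrt zero_le_two, rpow_def_of_pos (by positivity), ← exp_add, ← exp_nat_mul]
  push_cast
  ring_nf

end PredictionError

theorem mainTheorem8_general (C : ℝ) :
    ∃ K c : ℝ, 0 < K ∧ 0 < c ∧
      ∀ (H : Circle → ℝ≥0∞) (ρ : Measure Circle), Measurable H → IsFiniteMeasure ρ →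
        (∀ a : ℝ, 1 ≤ a → distribFun H a ≤ C / a) →
        expNegMeasure H ≤ ρ →
        ∀ n : ℕ, 1 ≤ n → c * (n : ℝ) ^ (-K) ≤ predError ρ n := by
  set D := max C 1
  have hD : 1 ≤ D := le_max_right C 1
  refine ⟨D, rexp (-(2 + D)) * (4 * D) ^ (-D) / √2, by positivity, by positivity,
    fun H ρ hH _ hC hρ n hn => ?_⟩
  have hweak : MemWeakL1With D H circleLebesgue := MemWeakL1With.mono hC (le_max_left C 1)
  have hn1 : (1 : ℝ) ≤ n := by exact_mod_cast hn
  have hpow : (4 * D) ^ (-D) * (n : ℝ) ^ (-D) ≤ (2 * D * (n + 1)) ^ (-D) := by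
    rw [← mul_rpow (by positivity) (by positivity)]
    exact rpow_le_rpow_of_nonpos (by positivity) (by nlinarith) (by linarith)
  calc rexp (-(2 + D)) * (4 * D) ^ (-D) / √2 * (n : ℝ) ^ (-D)
      = rexp (-(2 + D)) * ((4 * D) ^ (-D) * (n : ℝ) ^ (-D)) / √2 := by ring
    _ ≤ rexp (-(2 + D)) * (2 * D * (n + 1)) ^ (-D) / √2 := by gcongr
    _ ≤ predError ρ n := exp_mul_rpow_div_sqrt_two_le_predError hweak hH hD hρ n

theorem mainTheorem8 (C : ℝ) (hC : 0 < C) :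
    ∃ K : ℝ, 0 < K ∧
      ∀ (H : Circle → ℝ≥0∞) (ρ : Measure Circle), Measurable H → IsFiniteMeasure ρ →
        (∀ a : ℝ, 1 ≤ a → distribFun H a ≤ C / a) →
        expNegMeasure H ≤ ρ →
        ∃ c : ℝ, 0 < c ∧ ∀ n : ℕ, 1 ≤ n → c * (n : ℝ) ^ (-K) ≤ predError ρ n := by
  obtain ⟨K, c, hK, hc, hbound⟩ := mainTheorem8_general C
  exact ⟨K, hK, fun H ρ hH hfin hdist hρ => ⟨c, hc, hbound H ρ hH hfin hdist hρ⟩⟩
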